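/- **Setting.** Let $X_1,\dots,X_m$ be finitely many nominal attributes, each with finitely many values, and let $y$ be a class from a finite set of $c$ classes. Let $(\vec x_t,y_t)_{t\ge 1}$ be i.i.d. examples with an arbitrary common law $\mu$, and let $\delta\in(0,1)$. The information gain of an attribute, on a distribution or on counts, is the class entropy (in bits) minus the average class entropy within the branches of the split; the null attribute $X_\emptyset$ (no split) has gain $0$. **Asymptotic batch tree $DT_*$.** Start at the root with all attributes available and the law $\mu$. A node is a leaf if almost all examples reaching it have the same class, or if no available attribute has positive information gain under the law of the examples reaching the node; otherwise it splits on the available attribute of highest such gain, which is then no longer available below. Each branch is treated in the same way with the conditional law. A leaf predicts a most probable class. **Hoeffding Anytime Tree.** $HATT^t$ is the tree after $t$ examples, starting from a single leaf. Each example is sorted from the root to a leaf; at every visited node, in this order, the counts (value of an available attribute, class) are incremented, and then, with $n$ the number of examples seen at the node, $\epsilon=\sqrt{(\log_2 c)^2\ln(1/\delta)/(2n)}$, $\overline G$ the gains computed from the counts, and $X_a$ an element of highest $\overline G$ among the available attributes and $X_\emptyset$: * a leaf whose examples are not all of one class is split on $X_a$ if $X_a\neq X_\emptyset$ and $\overline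 G(X_a)-\overline G(X_\emptyset)>\epsilon$; * an internal node with current split $X_{cur}$ for which $\overline G(X_a)-\overline G(X_{cur})>\epsilon$ is replaced by a leaf if $X_a=X_\emptyset$, and by a split on $X_a$ if $X_a\ne X_\emptyset, X_{cur}$; the old subtrees (with their counts) are discarded, and the example is not processed further. A node keeps its own counts when it is split or its split is replaced; the branches of a new split are leaves with zero counts and with the split attribute no longer available. Each leaf predicts a majority class of the examples seen there. All ties are broken by arbitrary fixed rules. **Lemma 3.** Assume that at every node of $DT_*$ at which the class is not almost surely constant, no two distinct available attributes have equal information gain (under the law of the examples reaching that node), and that, if any attribute is available there, the best one has nonzero gain (it is not tied with $X_\emptyset$). Then $HATT^t$ converges in probability to $DT_*$: $$\lim_{t\to\infty}\Pr\bigl(HATT^t = DT_*\bigr)=1,$$ where two trees are equal if they have the same shape, the same split attribute at corresponding internal nodes, and the same predicted class at corresponding leaves, up to a tie between equally probable classes at that leaf. -/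

import Mathlib

open MeasureTheory ProbabilityTheory Filter Topology

noncomputable section

namespace HATT

universe u v w

/-- An example: a vector of attribute values (attribute `i` takes values in `V i`) and a class. -/
abbrev Example {ι : Type u} (V : ι → Type v) (C : Type w) : Type (max u v w) :=
  (∀ i, V i) × C

/-- A decision tree: a leaf predicts a class, an internal node tests the attribute `i` and has
one branch per value of `i`. -/
inductive DTree {ι : Type u} (V : ι → Type v) (C : Type w) : Type (max u v w)
  | leaf (c : C) : DTree V C
  | node (i : ι) (child : V i → DTree V C) : DTree V C

/-! ### Information gain -/

/-- Shannon entropy (in bits) of a vector of class frequencies. -/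
def entropy {C : Type w} [Fintype C] (p : C → ℝ) : ℝ :=
  (∑ k, Real.negMulLog (p k)) / Real.log 2

/-- Information gain of a split with values in `J`, computed from the (unnormalised) table
`m j k` of masses of the examples with value `j` and class `k`: the entropy of the class
distribution, minus the average over the branches of the entropy within the branch. -/
def infoGain {J : Type v} {C : Type w} [Fintype J] [Fintype C] (m : J → C → ℝ) : ℝ :=
  let total : ℝ := ∑ j, ∑ k, m j k
  entropy (fun k => (∑ j, m j k) / total) -
    ∑ j, ((∑ k, m j k) / total) * entropy (fun k => m j k / ∑ k', m j k')

/-- The gains of the candidates `Option ι`: `some i` is the attribute `i`; `none` is the null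
attribute (no split, predict the most frequent class), whose information gain is `0`. -/
def candidateGain {ι : Type u} (g : ι → ℝ) (o : Option ι) : ℝ := o.elim 0 g

/-- `sel` is a rule that selects from each nonempty finite set a maximiser of a given score
(the rule fixes how ties are broken). -/
def IsArgmaxRule {α : Type u} (sel : Finset α → (α → ℝ) → α) : Prop :=
  ∀ (s : Finset α) (g : α → ℝ), s.Nonempty → sel s g ∈ s ∧ ∀ a ∈ s, g a ≤ g (sel s g)

/-! ### The asymptotic batch tree

A node is described by the finite set `A` of attributes that have not been tested on the path to
it, and by the cell `E` of the examples that are sorted into it. -/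

section Batch

variable {ι : Type u} {V : ι → Type v} {C : Type w}

/-- The part of the cell `E` that goes down the branch `x i = a`. -/
def branch (E : Set (Example V C)) (i : ι) (a : V i) : Set (Example V C) :=
  {z ∈ E | z.1 i = a}

variable [∀ i, MeasurableSpace (V i)] [MeasurableSpace C]

/-- The probability that an example lies in `E` and has class `k`. -/
def classMass (μ : Measure (Example V C)) (E : Set (Example V C)) (k : C) : ℝ :=
  μ.real {z ∈ E | z.2 = k}

/-- Almost all the examples in `E` have the same class. -/
def IsPure (μ : Measure (Example V C)) (E : Set (Example V C)) : Prop :=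
  ∃ c, μ {z ∈ E | z.2 ≠ c} = 0

/-- The true information gain of the attribute `i` on the examples of the cell `E`. -/
def trueGain [∀ i, Fintype (V i)] [Fintype C]
    (μ : Measure (Example V C)) (E : Set (Example V C)) (i : ι) : ℝ :=
  infoGain fun (a : V i) (k : C) => μ.real {z ∈ E | z.1 i = a ∧ z.2 = k}

open Classical in
/-- The subtree of the asymptotic batch tree below the node `(A, E)`: unless the node is pure, it
splits on the untested attribute of highest true information gain, if that is better than not
splitting; a leaf predicts a most probable class. The test `i ∈ A` holds by the choice of `i`. -/
def batchTree [DecidableEq ι] [∀ i, Fintype (V i)] [Fintype C]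
    (pick : Finset (Option ι) → (Option ι → ℝ) → Option ι)
    (vote : Finset C → (C → ℝ) → C)
    (μ : Measure (Example V C)) (A : Finset ι) (E : Set (Example V C)) : DTree V C :=
  if IsPure μ E then .leaf (vote Finset.univ (classMass μ E))
  else
    match pick (Finset.insertNone A) (candidateGain (trueGain μ E)) with
    | none => .leaf (vote Finset.univ (classMass μ E))
    | some i =>
      if _h : i ∈ A then
        .node i fun a => batchTree pick vote μ (A.erase i) (branch E i a)
      else .leaf (vote Finset.univ (classMass μ E))
termination_by A.card
decreasing_by exact Finset.card_erase_lt_of_mem _h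

/-- There are no ties at the node `(A, E)`: unless the node is pure, any two distinct available
attributes have different information gains, and the best of them is not tied with the null
attribute, i.e. has nonzero (positive) gain. -/
def NoTies [∀ i, Fintype (V i)] [Fintype C]
    (μ : Measure (Example V C)) (A : Finset ι) (E : Set (Example V C)) : Prop :=
  ¬ IsPure μ E → Set.InjOn (trueGain μ E) A ∧ (A.Nonempty → ∃ i ∈ A, 0 < trueGain μ E i)

/-- There are no ties at any node of the given tree, whose root is the node `(A, E)`. -/
def NoTiesAlong [DecidableEq ι] [∀ i, Fintype (V i)] [Fintype C] (μ : Measure (Example V C)) :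
    Finset ι → Set (Example V C) → DTree V C → Prop
  | A, E, .leaf _ => NoTies μ A E
  | A, E, .node i child =>
      NoTies μ A E ∧ ∀ a, NoTiesAlong μ (A.erase i) (branch E i a) (child a)

/-- Two trees, on the cell `E`, are the same decision tree: they have the same shape, they test
the same attribute at corresponding internal nodes, and corresponding leaves predict the same
class, up to a tie between equally probable classes at that leaf. -/
inductive Agree (μ : Measure (Example V C)) : Set (Example V C) → DTree V C → DTree V C → Prop
  | leaf {E : Set (Example V C)} {c c' : C} (h : classMass μ E c = classMass μ E c') :
      Agree μ E (.leaf c) (.leaf c')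
  | node {E : Set (Example V C)} {i : ι} {child child' : V i → DTree V C}
      (h : ∀ a, Agree μ (branch E i a) (child a) (child' a)) :
      Agree μ E (.node i child) (.node i child')

end Batch

/-! ### Hoeffding Anytime Tree -/

/-- The counters of a node: `cls k` is the number of examples of class `k` seen at the node, and
`cnt i j k` the number of those for which, in addition, the attribute `i` has value `j`. -/
structure Counts {ι : Type u} (V : ι → Type v) (C : Type w) where
  cls : C → ℕ
  cnt : ∀ i, V i → C → ℕ

/-- The state of the algorithm: a tree all of whose nodes carry counters. -/
inductive HTree {ι : Type u} (V : ι → Type v) (C : Type w) : Type (max u v w)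
  | leaf (s : Counts V C) : HTree V C
  | node (s : Counts V C) (i : ι) (child : V i → HTree V C) : HTree V C

section Algorithm

variable {ι : Type u} {V : ι → Type v} {C : Type w}

/-- All counters are zero. -/
def Counts.zero : Counts V C where
  cls _ := 0
  cnt _ _ _ := 0

/-- Increment the counters of a node with available attributes `A` by the example `z`. -/
def Counts.add [DecidableEq ι] [∀ i, DecidableEq (V i)] [DecidableEq C]
    (s : Counts V C) (A : Finset ι) (z : Example V C) : Counts V C where
  cls k := if z.2 = k then s.cls k + 1 else s.cls k
  cnt i j k := if i ∈ A ∧ z.1 i = j ∧ z.2 = k then s.cnt i j k + 1 else s.cnt i j k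

/-- The number of examples seen at a node. -/
def Counts.size [Fintype C] (s : Counts V C) : ℕ := ∑ k, s.cls k

/-- All the examples seen at the node have the same class. -/
def Counts.SameClass (s : Counts V C) : Prop := ∃ c, ∀ k, k ≠ c → s.cls k = 0

/-- The observed information gain of the attribute `i` at a node. -/
def Counts.gain [∀ i, Fintype (V i)] [Fintype C] (s : Counts V C) (i : ι) : ℝ :=
  infoGain fun (j : V i) (k : C) => (s.cnt i j k : ℝ)

/-- The Hoeffding bound `√(R² ln(1/δ) / (2n))`, where `R` is the range of the information gain,
`log₂` of the number of classes. -/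
def hoeffdingBound (C : Type w) [Fintype C] (δ : ℝ) (n : ℕ) : ℝ :=
  Real.sqrt ((Real.logb 2 (Fintype.card C)) ^ 2 * Real.log (1 / δ) / (2 * n))

variable [DecidableEq ι] [∀ i, Fintype (V i)] [∀ i, DecidableEq (V i)]
  [Fintype C] [DecidableEq C]

/-- A new internal node that splits on `i` and keeps the counters `s` of the node it replaces;
the branches are new leaves whose counters are zero. -/
def freshSplit (s : Counts V C) (i : ι) : HTree V C :=
  .node s i fun _ => .leaf Counts.zero

open Classical in
/-- The attempt to split a leaf with available attributes `A` and counters `s`. -/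
def attemptToSplit (pick : Finset (Option ι) → (Option ι → ℝ) → Option ι) (δ : ℝ)
    (A : Finset ι) (s : Counts V C) : HTree V C :=
  if s.SameClass then .leaf s
  else
    match pick (Finset.insertNone A) (candidateGain s.gain) with
    | none => .leaf s
    | some a =>
      if candidateGain s.gain (some a) - candidateGain s.gain none > hoeffdingBound C δ s.size
      then freshSplit s a
      else .leaf s

open Classical in
/-- The re-evaluation of the split of an internal node with available attributes `A`, counters `s`
and current split attribute `i`. The result is the tree that replaces the node, or `none` if the
node and its subtrees are kept. -/
def reEvaluateBestSplit (pick : Finset (Option ι) → (Option ι → ℝ) → Option ι) (δ : ℝ)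
    (A : Finset ι) (s : Counts V C) (i : ι) : Option (HTree V C) :=
  let best := pick (Finset.insertNone A) (candidateGain s.gain)
  if candidateGain s.gain best - candidateGain s.gain (some i) > hoeffdingBound C δ s.size then
    match best with
    | none => some (.leaf s)
    | some a => if a ≠ i then some (freshSplit s a) else none
  else none

/-- Process one example: it is sorted down the tree, from the root to a leaf; at each node that it
visits the counters are incremented, then an internal node re-evaluates its split and a leaf
attempts to split. If a node is replaced, the subtree below it is discarded. -/
def process (pick : Finset (Option ι) → (Option ι → ℝ) → Option ι) (δ : ℝ) (z : Example V C) :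
    Finset ι → HTree V C → HTree V C
  | A, .leaf s => attemptToSplit pick δ A (s.add A z)
  | A, .node s i child =>
      match reEvaluateBestSplit pick δ A (s.add A z) i with
      | some T => T
      | none => .node (s.add A z) i
          (Function.update child (z.1 i) (process pick δ z (A.erase i) (child (z.1 i))))

/-- The decision tree held by a state: each leaf is labelled with the majority class of the
examples seen there. -/
def HTree.toDTree (vote : Finset C → (C → ℝ) → C) : HTree V C → DTree V C
  | .leaf s => .leaf (vote Finset.univ fun k => (s.cls k : ℝ))
  | .node _ i child => .node i fun a => (child a).toDTree vote

variable [Fintype ι]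

/-- The state after the first `t` examples of the stream `S`. -/
def state (pick : Finset (Option ι) → (Option ι → ℝ) → Option ι) (δ : ℝ) (S : ℕ → Example V C) :
    ℕ → HTree V C
  | 0 => .leaf Counts.zero
  | t + 1 => process pick δ (S t) Finset.univ (state pick δ S t)

/-- The tree built by Hoeffding Anytime Tree from the first `t` examples of the stream `S`. -/
def hatt (pick : Finset (Option ι) → (Option ι → ℝ) → Option ι) (vote : Finset C → (C → ℝ) → C)
    (δ : ℝ) (S : ℕ → Example V C) (t : ℕ) : DTree V C :=
  (state pick δ S t).toDTree vote

end Algorithm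

end HATT

end

set_option linter.unusedSectionVars false

noncomputable section

namespace HATT

universe u v w

/-! A node keeps its counters for as long as it exists, whatever splits are made there
(`counts_process`). They therefore count exactly the examples that have fallen into its cell since
its creation. By the strong law, almost every stream visits each set of examples with limiting
frequency equal to its probability and never visits a null set (`ae_typical`). The rest is
deterministic, along one such stream.

At a node that is not pure, the observed gains converge to the true ones and the Hoeffding bound
tends to `0`. Without ties, the best attribute thus eventually beats every other candidate by more
than the bound, for ever (`eventually_dominates`). The next visit installs this split and no later
one removes it, so each branch then evolves undisturbed as the history of a node (`cellRun`) created
at some time. Induction on the set of available attributes gives eventual agreement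
(`eventually_agree`). Pure nodes and nodes without attributes never split, and their majority class
settles by the law of large numbers. No concentration inequality is needed: the bound matters only
through being nonnegative and tending to `0`. -/

variable {ι : Type u} {V : ι → Type v} {C : Type w}

/-! ### Visits to a cell -/

open Classical in
/-- The number of examples of the stream `S` that fall into `E` at the times in `[τ, t)`. -/
def visits (S : ℕ → Example V C) (E : Set (Example V C)) (τ t : ℕ) : ℕ :=
  ((Finset.range t).filter fun n => τ ≤ n ∧ S n ∈ E).card

lemma visits_zero (S : ℕ → Example V C) (E : Set (Example V C)) (τ : ℕ) :
    visits S E τ 0 = 0 := by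
  simp [visits]

lemma visits_succ_of_mem {S : ℕ → Example V C} {E : Set (Example V C)} {τ t : ℕ}
    (h : τ ≤ t) (hE : S t ∈ E) : visits S E τ (t + 1) = visits S E τ t + 1 := by
  classical
  simp [visits, Finset.range_add_one, Finset.filter_insert, h, hE]

lemma visits_succ_of_not {S : ℕ → Example V C} {E : Set (Example V C)} {τ t : ℕ}
    (h : ¬ (τ ≤ t ∧ S t ∈ E)) : visits S E τ (t + 1) = visits S E τ t := by
  classical
  simp only [visits, Finset.range_add_one, Finset.filter_insert, if_neg h]

lemma visits_le_visits_zero (S : ℕ → Example V C) (E : Set (Example V C)) (τ t : ℕ) :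
    visits S E τ t ≤ visits S E 0 t := by
  classical
  refine Finset.card_le_card fun n hn => ?_
  simp only [Finset.mem_filter] at hn ⊢
  exact ⟨hn.1, Nat.zero_le _, hn.2.2⟩

/-- At most `τ` visits precede time `τ`, so the creation time of a node does not affect limiting
frequencies. -/
lemma visits_zero_le_add (S : ℕ → Example V C) (E : Set (Example V C)) (τ t : ℕ) :
    visits S E 0 t ≤ visits S E τ t + τ := by
  induction t with
  | zero => simp [visits_zero]
  | succ t ih =>
    by_cases hE : S t ∈ E
    · rw [visits_succ_of_mem (Nat.zero_le _) hE]
      by_cases hτ : τ ≤ t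
      · rw [visits_succ_of_mem hτ hE]; omega
      · have : visits S E 0 t ≤ t := by
          classical
          exact (Finset.card_filter_le _ _).trans (Finset.card_range t).le
        omega
    · rw [visits_succ_of_not (by tauto), visits_succ_of_not (by tauto)]; exact ih

/-- The class-`k` part of the cell `E`. -/
def classCell (E : Set (Example V C)) (k : C) : Set (Example V C) := {z ∈ E | z.2 = k}

/-- The part of the cell `E` with value `j` of the attribute `i` and class `k`. -/
def valueClassCell (E : Set (Example V C)) (i : ι) (j : V i) (k : C) : Set (Example V C) :=
  {z ∈ E | z.1 i = j ∧ z.2 = k}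

/-- The law of large numbers holds along the stream `S`: every set of examples has limiting
frequency given by `μ`, and null sets are never visited. -/
structure Typical [∀ i, MeasurableSpace (V i)] [MeasurableSpace C]
    (μ : Measure (Example V C)) (S : ℕ → Example V C) : Prop where
  freq : ∀ E, Tendsto (fun t : ℕ => (visits S E 0 t : ℝ) / t) atTop (𝓝 (μ.real E))
  notMem_of_null : ∀ E, μ E = 0 → ∀ t, S t ∉ E

section Typical

variable [∀ i, MeasurableSpace (V i)] [MeasurableSpace C] {μ : Measure (Example V C)}
  {S : ℕ → Example V C}

lemma Typical.tendsto_visits_div (hS : Typical μ S) (E : Set (Example V C)) (τ : ℕ) :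
    Tendsto (fun t : ℕ => (visits S E τ t : ℝ) / t) atTop (𝓝 (μ.real E)) := by
  have h0 : Tendsto (fun t : ℕ => (τ : ℝ) / t) atTop (𝓝 0) :=
    tendsto_const_div_atTop_nhds_zero_nat _
  have h1 := (hS.freq E).sub h0
  rw [sub_zero] at h1
  refine tendsto_of_tendsto_of_tendsto_of_le_of_le h1 (hS.freq E) (fun t => ?_) fun t => ?_
  · have : (visits S E 0 t : ℝ) ≤ visits S E τ t + τ := by
      exact_mod_cast visits_zero_le_add S E τ t
    have ht : (0 : ℝ) ≤ t := t.cast_nonneg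
    simp only [← sub_div]
    gcongr
    linarith
  · have : (visits S E τ t : ℝ) ≤ visits S E 0 t := by
      exact_mod_cast visits_le_visits_zero S E τ t
    have ht : (0 : ℝ) ≤ t := t.cast_nonneg
    simp only
    gcongr

lemma Typical.visits_eq_zero (hS : Typical μ S) {E : Set (Example V C)} (hE : μ E = 0)
    (τ t : ℕ) : visits S E τ t = 0 := by
  classical
  simp only [visits, Finset.card_eq_zero, Finset.filter_eq_empty_iff]
  exact fun n _ h => hS.notMem_of_null E hE n h.2

lemma Typical.tendsto_visits_atTop [IsFiniteMeasure μ] (hS : Typical μ S)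
    {E : Set (Example V C)} (hE : μ E ≠ 0) (τ : ℕ) :
    Tendsto (visits S E τ) atTop atTop := by
  have hpos : 0 < μ.real E := ENNReal.toReal_pos hE (measure_ne_top _ _)
  have h := (hS.tendsto_visits_div E τ).pos_mul_atTop hpos
    (tendsto_natCast_atTop_atTop (R := ℝ))
  refine tendsto_natCast_atTop_iff.mp (h.congr' ?_)
  filter_upwards [eventually_gt_atTop 0] with t ht
  have : (t : ℝ) ≠ 0 := by positivity
  field_simp

lemma Typical.exists_visit [IsFiniteMeasure μ] (hS : Typical μ S)
    {E : Set (Example V C)} (hE : μ E ≠ 0) (τ : ℕ) : ∃ t, τ ≤ t ∧ S t ∈ E := by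
  classical
  by_contra! h
  have h0 : ∀ t, visits S E τ t = 0 := fun t => by
    simp only [visits, Finset.card_eq_zero, Finset.filter_eq_empty_iff]
    exact fun n _ hn => h n hn.1 hn.2
  obtain ⟨t, ht⟩ := ((hS.tendsto_visits_atTop hE τ).eventually_gt_atTop 0).exists
  simp [h0] at ht

end Typical

/-! ### Continuity of the information gain -/

section Gain

variable {J : Type v} [Fintype J] [Fintype C]

lemma continuous_entropy : Continuous (entropy : (C → ℝ) → ℝ) := by
  unfold entropy
  have := Real.continuous_negMulLog
  fun_prop

/-- Scale invariance allows counts to be divided by the global time `t`, instead of the number of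
examples at the node. -/
lemma infoGain_div (m : J → C → ℝ) {r : ℝ} (hr : r ≠ 0) :
    infoGain (fun j k => m j k / r) = infoGain m := by
  simp only [infoGain, ← Finset.sum_div, div_div_div_cancel_right₀ hr]

/-- The information gain is continuous along tables that vanish on the branches on which the
limit table does. -/
lemma tendsto_infoGain {m : ℕ → J → C → ℝ} {M : J → C → ℝ}
    (hm : ∀ j k, Tendsto (fun t => m t j k) atTop (𝓝 (M j k)))
    (hM : ∑ j, ∑ k, M j k ≠ 0)
    (hzero : ∀ j, ∑ k, M j k = 0 → ∀ t, ∑ k, m t j k = 0) :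
    Tendsto (fun t => infoGain (m t)) atTop (𝓝 (infoGain M)) := by
  have htot : Tendsto (fun t => ∑ j, ∑ k, m t j k) atTop (𝓝 (∑ j, ∑ k, M j k)) :=
    tendsto_finsetSum _ fun j _ => tendsto_finsetSum _ fun k _ => hm j k
  refine Tendsto.sub ?_ (tendsto_finsetSum _ fun j _ => ?_)
  · refine (continuous_entropy.tendsto _).comp (tendsto_pi_nhds.2 fun k => ?_)
    exact (tendsto_finsetSum _ fun j _ => hm j k).div htot hM
  -- On a branch of zero limiting mass the inner frequencies tend to no definite limit; `hzero`
  -- makes the whole term vanish identically.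
  · by_cases hj : ∑ k, M j k = 0
    · simp only [hj, hzero j hj, zero_div, zero_mul]
      exact tendsto_const_nhds
    · have hb : Tendsto (fun t => ∑ k, m t j k) atTop (𝓝 (∑ k, M j k)) :=
        tendsto_finsetSum _ fun k _ => hm j k
      refine (hb.div htot hM).mul ((continuous_entropy.tendsto _).comp
        (tendsto_pi_nhds.2 fun k => ?_))
      exact (hm j k).div hb hj

lemma tendsto_hoeffdingBound (C : Type w) [Fintype C] (δ : ℝ) :
    Tendsto (hoeffdingBound C δ) atTop (𝓝 0) := by
  have h : Tendsto (fun n : ℕ => (Real.logb 2 (Fintype.card C)) ^ 2 * Real.log (1 / δ) / 2 / n)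
      atTop (𝓝 0) := tendsto_const_div_atTop_nhds_zero_nat _
  have h2 := (Real.continuous_sqrt.tendsto 0).comp h
  rw [Real.sqrt_zero] at h2
  refine h2.congr fun n => ?_
  simp [hoeffdingBound, div_div]

end Gain

/-! ### The history of a node -/

section Run

variable [DecidableEq ι] [∀ i, Fintype (V i)] [∀ i, DecidableEq (V i)]
  [Fintype C] [DecidableEq C]

/-- The counters of the root. -/
def HTree.counts : HTree V C → Counts V C
  | .leaf s => s
  | .node s _ _ => s

lemma counts_attemptToSplit (pick : Finset (Option ι) → (Option ι → ℝ) → Option ι) (δ : ℝ)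
    (A : Finset ι) (s : Counts V C) : (attemptToSplit pick δ A s).counts = s := by
  unfold attemptToSplit
  split_ifs
  · rfl
  · split
    · rfl
    · split_ifs <;> rfl

lemma counts_of_reEvaluateBestSplit {pick : Finset (Option ι) → (Option ι → ℝ) → Option ι}
    {δ : ℝ} {A : Finset ι} {s : Counts V C} {i : ι} {T : HTree V C}
    (h : reEvaluateBestSplit pick δ A s i = some T) : T.counts = s := by
  simp only [reEvaluateBestSplit] at h
  split_ifs at h
  split at h
  · cases h; rfl
  · split_ifs at h
    cases h; rfl

/-- Leaving, splitting or replacing a node all preserve its updated counters, so the counters are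
independent of the decisions taken. -/
lemma counts_process (pick : Finset (Option ι) → (Option ι → ℝ) → Option ι) (δ : ℝ)
    (z : Example V C) (A : Finset ι) (T : HTree V C) :
    (process pick δ z A T).counts = T.counts.add A z := by
  cases T with
  | leaf s => rw [process, counts_attemptToSplit]; rfl
  | node s i child =>
    rw [process]
    split
    · rename_i h; exact counts_of_reEvaluateBestSplit h
    · rfl

open Classical in
/-- The subtree at the node `(A, E)` at time `t`, if this node is created at time `τ` and is not
discarded afterwards. -/
def cellRun (pick : Finset (Option ι) → (Option ι → ℝ) → Option ι) (δ : ℝ)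
    (S : ℕ → Example V C) (A : Finset ι) (E : Set (Example V C)) (τ : ℕ) : ℕ → HTree V C
  | 0 => .leaf Counts.zero
  | t + 1 =>
    if τ ≤ t ∧ S t ∈ E then process pick δ (S t) A (cellRun pick δ S A E τ t)
    else cellRun pick δ S A E τ t

variable {pick : Finset (Option ι) → (Option ι → ℝ) → Option ι} {δ : ℝ}
  {S : ℕ → Example V C} {A : Finset ι} {E : Set (Example V C)} {τ t : ℕ}

lemma cellRun_succ_of_mem (h : τ ≤ t) (hE : S t ∈ E) :
    cellRun pick δ S A E τ (t + 1) = process pick δ (S t) A (cellRun pick δ S A E τ t) := by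
  rw [cellRun, if_pos ⟨h, hE⟩]

lemma cellRun_succ_of_not (h : ¬ (τ ≤ t ∧ S t ∈ E)) :
    cellRun pick δ S A E τ (t + 1) = cellRun pick δ S A E τ t := by
  rw [cellRun, if_neg h]

/-- The default value before creation is the fresh leaf, which is also the initial state of a
branch. -/
lemma cellRun_of_le (h : t ≤ τ) : cellRun pick δ S A E τ t = .leaf Counts.zero := by
  induction t with
  | zero => rfl
  | succ t ih => rw [cellRun_succ_of_not (by omega), ih (by omega)]

/-- The whole algorithm is the history of the root, so an induction over nodes covers it. -/
lemma state_eq_cellRun [Fintype ι] (pick : Finset (Option ι) → (Option ι → ℝ) → Option ι)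
    (δ : ℝ) (S : ℕ → Example V C) (t : ℕ) :
    state pick δ S t = cellRun pick δ S Finset.univ Set.univ 0 t := by
  induction t with
  | zero => rfl
  | succ t ih => rw [state, cellRun_succ_of_mem (Nat.zero_le _) (Set.mem_univ _), ih]

lemma cellRun_cls (k : C) :
    (cellRun pick δ S A E τ t).counts.cls k = visits S (classCell E k) τ t := by
  induction t with
  | zero => rw [visits_zero]; rfl
  | succ t ih =>
    by_cases h : τ ≤ t ∧ S t ∈ E
    · rw [cellRun_succ_of_mem h.1 h.2, counts_process]
      by_cases hk : (S t).2 = k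
      · rw [visits_succ_of_mem (E := classCell E k) h.1 ⟨h.2, hk⟩, ← ih]; simp [Counts.add, hk]
      · rw [visits_succ_of_not (fun h' => hk h'.2.2), ← ih]; simp [Counts.add, hk]
    · rw [cellRun_succ_of_not h, visits_succ_of_not (t := t) (fun h' => h ⟨h'.1, h'.2.1⟩), ih]

lemma cellRun_cnt {i : ι} (hi : i ∈ A) (j : V i) (k : C) :
    (cellRun pick δ S A E τ t).counts.cnt i j k = visits S (valueClassCell E i j k) τ t := by
  induction t with
  | zero => rw [visits_zero]; rfl
  | succ t ih =>
    by_cases h : τ ≤ t ∧ S t ∈ E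
    · rw [cellRun_succ_of_mem h.1 h.2, counts_process]
      by_cases hk : (S t).1 i = j ∧ (S t).2 = k
      · rw [visits_succ_of_mem (E := valueClassCell E i j k) h.1 ⟨h.2, hk⟩, ← ih]; simp [Counts.add, hk, hi]
      · rw [visits_succ_of_not (fun h' => hk h'.2.2), ← ih]
        simp only [Counts.add, hi, true_and, if_neg hk]
    · rw [cellRun_succ_of_not h, visits_succ_of_not (t := t) (fun h' => h ⟨h'.1, h'.2.1⟩), ih]

lemma cellRun_size : (cellRun pick δ S A E τ t).counts.size = visits S E τ t := by
  induction t with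
  | zero => rw [visits_zero]; simp [Counts.size, cellRun, HTree.counts, Counts.zero]
  | succ t ih =>
    by_cases h : τ ≤ t ∧ S t ∈ E
    · rw [cellRun_succ_of_mem h.1 h.2, counts_process, visits_succ_of_mem h.1 h.2, ← ih]
      have : ∀ s : Counts V C, ∀ k,
          (if (S t).2 = k then s.cls k + 1 else s.cls k)
            = s.cls k + if (S t).2 = k then 1 else 0 := fun s k => by split_ifs <;> rfl
      simp [Counts.size, Counts.add, this, Finset.sum_add_distrib]
    · rw [cellRun_succ_of_not h, visits_succ_of_not h, ih]

/-- If the root of `T` is an internal node, it tests an available attribute and each of its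
branches is the history of a node that was created at some earlier time. -/
def ChildrenAreRuns (pick : Finset (Option ι) → (Option ι → ℝ) → Option ι) (δ : ℝ)
    (S : ℕ → Example V C) (A : Finset ι) (E : Set (Example V C)) (t : ℕ) (T : HTree V C) : Prop :=
  ∀ s i child, T = .node s i child → i ∈ A ∧
    ∀ a, ∃ τ, child a = cellRun pick δ S (A.erase i) (branch E i a) τ t

lemma childrenAreRuns_leaf (s : Counts V C) :
    ChildrenAreRuns pick δ S A E t (.leaf s) := by
  intro s i child h; cases h

lemma childrenAreRuns_freshSplit (s : Counts V C) {i : ι} (hi : i ∈ A) :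
    ChildrenAreRuns pick δ S A E t (freshSplit s i) := by
  intro s' i' child h
  cases h
  -- New branches are created at the current time `t`.
  exact ⟨hi, fun a => ⟨t, (cellRun_of_le le_rfl).symm⟩⟩

lemma IsArgmaxRule.mem_of_eq_some (hpick : IsArgmaxRule pick) {g : Option ι → ℝ} {i : ι}
    (h : pick (Finset.insertNone A) g = some i) : i ∈ A := by
  have := (hpick (Finset.insertNone A) g ⟨none, Finset.none_mem_insertNone⟩).1
  rw [h] at this
  exact Finset.some_mem_insertNone.1 this

lemma childrenAreRuns_attemptToSplit (hpick : IsArgmaxRule pick) (s : Counts V C) :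
    ChildrenAreRuns pick δ S A E t (attemptToSplit pick δ A s) := by
  unfold attemptToSplit
  split_ifs
  · exact childrenAreRuns_leaf s
  · split
    · exact childrenAreRuns_leaf s
    · rename_i h
      split_ifs
      · exact childrenAreRuns_freshSplit s (hpick.mem_of_eq_some h)
      · exact childrenAreRuns_leaf s

lemma childrenAreRuns_reEvaluate (hpick : IsArgmaxRule pick) {s : Counts V C} {i : ι}
    {T : HTree V C} (h : reEvaluateBestSplit pick δ A s i = some T) :
    ChildrenAreRuns pick δ S A E t T := by
  simp only [reEvaluateBestSplit] at h
  split_ifs at h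
  split at h
  · cases h; exact childrenAreRuns_leaf s
  · rename_i hp
    split_ifs at h
    cases h
    exact childrenAreRuns_freshSplit s (hpick.mem_of_eq_some hp)

/-- A branch whose root is kept evolves as the history of a node. -/
lemma update_eq_cellRun {i : ι} {child : V i → HTree V C} {a : V i} {τ' : ℕ} (hE : S t ∈ E)
    (hτ : τ' ≤ t) (h : child a = cellRun pick δ S (A.erase i) (branch E i a) τ' t) :
    Function.update child ((S t).1 i)
        (process pick δ (S t) (A.erase i) (child ((S t).1 i))) a
      = cellRun pick δ S (A.erase i) (branch E i a) τ' (t + 1) := by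
  by_cases ha : (S t).1 i = a
  · subst ha
    rw [Function.update_self, cellRun_succ_of_mem (E := branch E i ((S t).1 i)) hτ ⟨hE, rfl⟩, h]
  · rw [Function.update_of_ne (Ne.symm ha), cellRun_succ_of_not (fun h' => ha h'.2.2), h]

/-- A creation time in the future can be replaced by `t`, both giving the fresh leaf. Without `τ ≤
t`, the run would skip the example that arrives at time `t`. -/
lemma exists_cellRun_le {T : HTree V C} (h : ∃ τ, T = cellRun pick δ S A E τ t) :
    ∃ τ ≤ t, T = cellRun pick δ S A E τ t := by
  obtain ⟨τ, h⟩ := h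
  rcases le_total τ t with h' | h'
  · exact ⟨τ, h', h⟩
  · exact ⟨t, le_rfl, by rw [h, cellRun_of_le h', cellRun_of_le le_rfl]⟩

/-- Induction on time: a replaced root has fresh branches, and a kept root passes the example only
to the branch whose cell contains it. The creation times may change with every replacement, hence
the existential. -/
lemma childrenAreRuns_cellRun (hpick : IsArgmaxRule pick) :
    ChildrenAreRuns pick δ S A E t (cellRun pick δ S A E τ t) := by
  induction t with
  | zero => exact childrenAreRuns_leaf _
  | succ t ih =>
    by_cases h : τ ≤ t ∧ S t ∈ E
    · rw [cellRun_succ_of_mem h.1 h.2]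
      cases hT : cellRun pick δ S A E τ t with
      | leaf s => rw [process]; exact childrenAreRuns_attemptToSplit hpick _
      | node s i child =>
        rw [process]
        split
        · rename_i h'; exact childrenAreRuns_reEvaluate hpick h'
        · intro s' i' child' h'
          cases h'
          obtain ⟨hi, hc⟩ := ih s i child hT
          refine ⟨hi, fun a => ?_⟩
          obtain ⟨τ', hτ', hca⟩ := exists_cellRun_le (hc a)
          exact ⟨τ', update_eq_cellRun h.2 hτ' hca⟩
    · rw [cellRun_succ_of_not h]
      intro s i child hT
      obtain ⟨hi, hc⟩ := ih s i child hT
      refine ⟨hi, fun a => ?_⟩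
      obtain ⟨τ', hca⟩ := hc a
      refine ⟨τ', ?_⟩
      rw [hca, cellRun_succ_of_not fun h' => ?_]
      -- A skipped example either misses `E`, hence every branch of it, or comes before `τ`, when
      -- the root is still a leaf.
      by_cases hτ : τ ≤ t
      · exact h ⟨hτ, h'.2.1⟩
      · rw [cellRun_of_le (by omega)] at hT
        cases hT

/-- At a node with available attributes `A` and counters `s`, not all the examples are of the same
class, and `i` beats every other candidate by more than the Hoeffding bound. -/
def Dominates (δ : ℝ) (A : Finset ι) (s : Counts V C) (i : ι) : Prop :=
  ¬ s.SameClass ∧ ∀ o ∈ Finset.insertNone A, o ≠ some i →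
    candidateGain s.gain o + hoeffdingBound C δ s.size < candidateGain s.gain (some i)

lemma hoeffdingBound_nonneg (n : ℕ) : 0 ≤ hoeffdingBound C δ n := Real.sqrt_nonneg _

/-- The bound is nonnegative, so `i` is the strict maximiser and the tie-breaking rule plays no
role. -/
lemma Dominates.pick_eq {s : Counts V C} {i : ι} (h : Dominates δ A s i)
    (hpick : IsArgmaxRule pick) (hi : i ∈ A) :
    pick (Finset.insertNone A) (candidateGain s.gain) = some i := by
  obtain ⟨hmem, hmax⟩ := hpick (Finset.insertNone A) (candidateGain s.gain)
    ⟨none, Finset.none_mem_insertNone⟩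
  by_contra hne
  have h1 := h.2 _ hmem hne
  have h2 := hmax (some i) (Finset.some_mem_insertNone.2 hi)
  have h3 := hoeffdingBound_nonneg (C := C) (δ := δ) s.size
  linarith

lemma Dominates.attemptToSplit_eq {s : Counts V C} {i : ι} (h : Dominates δ A s i)
    (hpick : IsArgmaxRule pick) (hi : i ∈ A) :
    attemptToSplit pick δ A s = freshSplit s i := by
  have hgt := h.2 none Finset.none_mem_insertNone (by simp)
  rw [attemptToSplit, if_neg h.1, h.pick_eq hpick hi]
  simp only
  rw [if_pos (by linarith)]

lemma Dominates.reEvaluate_self {s : Counts V C} {i : ι} (h : Dominates δ A s i)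
    (hpick : IsArgmaxRule pick) (hi : i ∈ A) :
    reEvaluateBestSplit pick δ A s i = none := by
  have h3 := hoeffdingBound_nonneg (C := C) (δ := δ) s.size
  simp only [reEvaluateBestSplit, h.pick_eq hpick hi, sub_self]
  rw [if_neg (by linarith)]

lemma Dominates.reEvaluate_of_ne {s : Counts V C} {i j : ι} (h : Dominates δ A s i)
    (hpick : IsArgmaxRule pick) (hi : i ∈ A) (hj : j ∈ A) (hij : i ≠ j) :
    reEvaluateBestSplit pick δ A s j = some (freshSplit s i) := by
  have hgt := h.2 (some j) (Finset.some_mem_insertNone.2 hj) (by simpa using hij.symm)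
  simp only [reEvaluateBestSplit, h.pick_eq hpick hi]
  rw [if_pos (by linarith), if_pos hij]

/-- A visit at which `i` dominates leaves the root with the split attribute `i`. -/
lemma Dominates.exists_process_eq {z : Example V C} {i : ι} {T : HTree V C}
    (h : Dominates δ A (T.counts.add A z) i) (hpick : IsArgmaxRule pick) (hi : i ∈ A)
    (hT : ∀ s j child, T = .node s j child → j ∈ A) :
    ∃ s child, process pick δ z A T = .node s i child := by
  cases T with
  | leaf s => exact ⟨_, _, by rw [process]; exact h.attemptToSplit_eq hpick hi⟩
  | node s j child =>
    simp only [HTree.counts] at h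
    by_cases hij : i = j
    · subst hij
      exact ⟨_, _, by rw [process, h.reEvaluate_self hpick hi]⟩
    · exact ⟨_, _, by
        rw [process, h.reEvaluate_of_ne hpick hi (hT s j child rfl) hij]; rfl⟩

/-- Once the root tests an attribute that dominates for ever, its branches are never discarded. -/
lemma cellRun_eq_node_of_dominates (hpick : IsArgmaxRule pick) {i : ι} (hi : i ∈ A) {T : ℕ}
    (hdom : ∀ t, T ≤ t → Dominates δ A (cellRun pick δ S A E τ t).counts i) {σ : V i → ℕ}
    (hσ : ∀ a, σ a ≤ T) (hT : ∃ s child, cellRun pick δ S A E τ T = .node s i child ∧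
      ∀ a, child a = cellRun pick δ S (A.erase i) (branch E i a) (σ a) T)
    (t : ℕ) (ht : T ≤ t) :
    ∃ s child, cellRun pick δ S A E τ t = .node s i child ∧
      ∀ a, child a = cellRun pick δ S (A.erase i) (branch E i a) (σ a) t := by
  induction t, ht using Nat.le_induction with
  | base => exact hT
  | succ t ht ih =>
    obtain ⟨s, child, hrun, hchild⟩ := ih
    by_cases h : τ ≤ t ∧ S t ∈ E
    · have hd := hdom (t + 1) (by omega)
      rw [cellRun_succ_of_mem h.1 h.2, counts_process, hrun] at hd
      refine ⟨s.add A (S t), _, ?_, fun a => update_eq_cellRun h.2 ((hσ a).trans ht) (hchild a)⟩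
      rw [cellRun_succ_of_mem h.1 h.2, hrun, process]
      simp only [HTree.counts] at hd
      rw [hd.reEvaluate_self hpick hi]
    · refine ⟨s, child, by rw [cellRun_succ_of_not h, hrun], fun a => ?_⟩
      rw [hchild a, cellRun_succ_of_not fun h' => ?_]
      by_cases hτ : τ ≤ t
      · exact h ⟨hτ, h'.2.1⟩
      · rw [cellRun_of_le (by omega)] at hrun
        cases hrun

/-- The run stays a leaf if no attempt to split succeeds. -/
lemma cellRun_eq_leaf
    (h : ∀ t, attemptToSplit pick δ A (cellRun pick δ S A E τ t).counts
      = .leaf (cellRun pick δ S A E τ t).counts) (t : ℕ) :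
    cellRun pick δ S A E τ t = .leaf (cellRun pick δ S A E τ t).counts := by
  induction t with
  | zero => rfl
  | succ t ih =>
    by_cases hv : τ ≤ t ∧ S t ∈ E
    · have h' := h (t + 1)
      rw [cellRun_succ_of_mem hv.1 hv.2, counts_process] at h' ⊢
      conv_lhs => rw [ih, process]
      exact h'
    · rw [cellRun_succ_of_not hv]; exact ih

end Run

/-! ### Convergence along a typical stream -/

section Convergence

variable [DecidableEq ι] [∀ i, Fintype (V i)] [∀ i, DecidableEq (V i)]
  [Fintype C] [DecidableEq C] [∀ i, MeasurableSpace (V i)] [MeasurableSpace C]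
  {pick : Finset (Option ι) → (Option ι → ℝ) → Option ι} {vote : Finset C → (C → ℝ) → C}
  {δ : ℝ} {μ : Measure (Example V C)} [IsFiniteMeasure μ] {S : ℕ → Example V C}
  {A : Finset ι} {E : Set (Example V C)}

/-- A strictly less probable class eventually has strictly smaller frequency than `k₀`. Equally
probable classes may alternate for ever, so only the masses are compared. -/
lemma eventually_vote [Nonempty C] (hvote : IsArgmaxRule vote) (hS : Typical μ S) (τ : ℕ) :
    ∀ᶠ t in atTop,
      classMass μ E (vote Finset.univ fun k =>
        ((cellRun pick δ S A E τ t).counts.cls k : ℝ))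
      = classMass μ E (vote Finset.univ (classMass μ E)) := by
  set k₀ := vote Finset.univ (classMass μ E) with hk₀
  have hmax : ∀ k, classMass μ E k ≤ classMass μ E k₀ := fun k =>
    (hvote Finset.univ (classMass μ E) Finset.univ_nonempty).2 k (Finset.mem_univ k)
  have key : ∀ k, ∀ᶠ t in atTop, classMass μ E k < classMass μ E k₀ →
      (visits S (classCell E k) τ t : ℝ) / t < (visits S (classCell E k₀) τ t : ℝ) / t := by
    intro k
    by_cases h : classMass μ E k < classMass μ E k₀
    · filter_upwards [(hS.tendsto_visits_div (classCell E k) τ).eventually_lt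
        (hS.tendsto_visits_div (classCell E k₀) τ) h] with t ht _ using ht
    · exact Eventually.of_forall fun t h' => absurd h' h
  filter_upwards [eventually_all.2 key, eventually_gt_atTop 0] with t ht ht0
  refine le_antisymm (hmax _) (not_lt.1 fun hlt => ?_)
  have h1 := ht _ hlt
  have h2 := (hvote Finset.univ (fun k => ((cellRun pick δ S A E τ t).counts.cls k : ℝ))
    Finset.univ_nonempty).2 k₀ (Finset.mem_univ _)
  simp only [cellRun_cls] at h1 h2
  have ht' : (0 : ℝ) < t := by exact_mod_cast ht0
  rw [div_lt_div_iff_of_pos_right ht'] at h1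
  linarith

lemma tendsto_gain (hS : Typical μ S) (hE : μ E ≠ 0) (τ : ℕ) {i : ι} (hi : i ∈ A) :
    Tendsto (fun t => (cellRun pick δ S A E τ t).counts.gain i) atTop
      (𝓝 (trueGain μ E i)) := by
  -- The finitely many cells of the table cover `E`, so they cannot all be null.
  have hM : ∑ j : V i, ∑ k : C, μ.real (valueClassCell E i j k) ≠ 0 := by
    intro h
    apply hE
    have hsub : E ⊆ ⋃ j : V i, ⋃ k : C, valueClassCell E i j k := fun z hz =>
      Set.mem_iUnion₂.2 ⟨z.1 i, z.2, hz, rfl, rfl⟩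
    refine measure_mono_null hsub (measure_iUnion_null fun j => measure_iUnion_null fun k => ?_)
    rw [Finset.sum_eq_zero_iff_of_nonneg
      fun j _ => Finset.sum_nonneg fun k _ => measureReal_nonneg] at h
    have hj := h j (Finset.mem_univ j)
    rw [Finset.sum_eq_zero_iff_of_nonneg fun k _ => measureReal_nonneg] at hj
    exact (measureReal_eq_zero_iff).1 (hj k (Finset.mem_univ k))
  have hlim := tendsto_infoGain
    (m := fun (t : ℕ) (j : V i) (k : C) => (visits S (valueClassCell E i j k) τ t : ℝ) / t)
    (M := fun j k => μ.real (valueClassCell E i j k))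
    (fun j k => hS.tendsto_visits_div _ τ) hM fun j hj t => by
      rw [Finset.sum_eq_zero_iff_of_nonneg fun k _ => measureReal_nonneg] at hj
      refine Finset.sum_eq_zero fun k hk => ?_
      rw [hS.visits_eq_zero ((measureReal_eq_zero_iff).1 (hj k hk)), Nat.cast_zero, zero_div]
  refine Tendsto.congr' ?_ hlim
  filter_upwards [eventually_gt_atTop 0] with t ht
  rw [infoGain_div _ (by positivity), Counts.gain]
  simp only [cellRun_cnt hi]

/-- A null cell counts as pure, so every node that needs a split is visited infinitely often along a
typical stream. -/
lemma measure_ne_zero_of_not_isPure [Nonempty C] (h : ¬ IsPure μ E) : μ E ≠ 0 := fun h0 =>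
  h ⟨Classical.arbitrary C, measure_mono_null (fun _ hz => hz.1) h0⟩

/-- The exceptional classes form a null set, which is never visited; the conclusion thus holds at
all times, and the node never splits. -/
lemma sameClass_of_isPure (hS : Typical μ S) (h : IsPure μ E) (τ t : ℕ) :
    (cellRun pick δ S A E τ t).counts.SameClass := by
  obtain ⟨c, hc⟩ := h
  refine ⟨c, fun k hk => ?_⟩
  rw [cellRun_cls]
  refine hS.visits_eq_zero (measure_mono_null (fun z hz => ?_) hc) τ t
  exact ⟨hz.1, fun h => hk (hz.2.symm.trans h)⟩

lemma eventually_not_sameClass (hS : Typical μ S) (h : ¬ IsPure μ E) (τ : ℕ) :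
    ∀ᶠ t in atTop, ¬ (cellRun pick δ S A E τ t).counts.SameClass := by
  have key : ∀ c, ∀ᶠ t in atTop,
      ∃ k, k ≠ c ∧ (cellRun pick δ S A E τ t).counts.cls k ≠ 0 := by
    intro c
    obtain ⟨k, hk, hμk⟩ : ∃ k, k ≠ c ∧ μ (classCell E k) ≠ 0 := by
      by_contra! h'
      refine h ⟨c, measure_mono_null (t := ⋃ k, ⋃ _ : k ≠ c, classCell E k)
        (fun z hz => Set.mem_iUnion₂.2 ⟨z.2, hz.2, hz.1, rfl⟩) ?_⟩
      exact measure_iUnion_null fun k => measure_iUnion_null fun hk => h' k hk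
    filter_upwards [(hS.tendsto_visits_atTop hμk τ).eventually_gt_atTop 0] with t ht
    exact ⟨k, hk, by rw [cellRun_cls]; omega⟩
  filter_upwards [eventually_all.2 key] with t ht
  rintro ⟨c, hc⟩
  obtain ⟨k, hk, hne⟩ := ht c
  exact hne (hc k hk)

lemma eventually_dominates [Nonempty C] (hS : Typical μ S) (hE : ¬ IsPure μ E) {i : ι}
    (hi : i ∈ A) (hpos : 0 < trueGain μ E i)
    (hbest : ∀ j ∈ A, j ≠ i → trueGain μ E j < trueGain μ E i) (τ : ℕ) :
    ∀ᶠ t in atTop, Dominates δ A (cellRun pick δ S A E τ t).counts i := by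
  have hμE := measure_ne_zero_of_not_isPure hE
  have hbound : Tendsto (fun t => hoeffdingBound C δ (cellRun pick δ S A E τ t).counts.size)
      atTop (𝓝 0) := by
    simp only [cellRun_size]
    exact (tendsto_hoeffdingBound C δ).comp (hS.tendsto_visits_atTop hμE τ)
  have hgi := tendsto_gain (pick := pick) (δ := δ) hS hμE τ hi
  have key : ∀ o ∈ Finset.insertNone A, ∀ᶠ t in atTop, o ≠ some i →
      candidateGain (cellRun pick δ S A E τ t).counts.gain o
        + hoeffdingBound C δ (cellRun pick δ S A E τ t).counts.size
        < candidateGain (cellRun pick δ S A E τ t).counts.gain (some i) := by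
    rintro (_ | j) ho
    · filter_upwards [(hbound.const_add 0).eventually_lt hgi (by simpa using hpos)] with t ht _
        using ht
    · have hj : j ∈ A := Finset.some_mem_insertNone.1 ho
      by_cases hji : j = i
      · exact Eventually.of_forall fun t h => absurd (congrArg some hji) h
      · filter_upwards [((tendsto_gain (pick := pick) (δ := δ) hS hμE τ hj).add
          hbound).eventually_lt hgi (by simpa using hbest j hj hji)] with t ht _ using ht
  filter_upwards [eventually_not_sameClass hS hE τ,
    (Filter.eventually_all_finset _).2 key] with t h1 h2
  exact ⟨h1, h2⟩

/-- Injectivity of the gains makes the maximiser strict, and an attribute of positive gain rules out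
the null candidate. -/
lemma IsArgmaxRule.exists_best (hpick : IsArgmaxRule pick) (hE : ¬ IsPure μ E)
    (h : NoTies μ A E) (hA : A.Nonempty) :
    ∃ i ∈ A, pick (Finset.insertNone A) (candidateGain (trueGain μ E)) = some i ∧
      0 < trueGain μ E i ∧ ∀ j ∈ A, j ≠ i → trueGain μ E j < trueGain μ E i := by
  obtain ⟨hinj, hex⟩ := h hE
  obtain ⟨j₀, hj₀, hpos⟩ := hex hA
  obtain ⟨-, hmax⟩ := hpick (Finset.insertNone A) (candidateGain (trueGain μ E))
    ⟨none, Finset.none_mem_insertNone⟩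
  have hmaxA : ∀ j ∈ A, _ := fun j hj => hmax (some j) (Finset.some_mem_insertNone.2 hj)
  cases hp : pick (Finset.insertNone A) (candidateGain (trueGain μ E)) with
  | none =>
    rw [hp] at hmaxA
    exact absurd (hmaxA j₀ hj₀) (not_le.2 hpos)
  | some i =>
    rw [hp] at hmaxA
    have hi := hpick.mem_of_eq_some hp
    refine ⟨i, hi, rfl, hpos.trans_le (hmaxA j₀ hj₀), fun j hj hji => ?_⟩
    exact lt_of_le_of_ne (hmaxA j hj) fun heq => hji (hinj hj hi heq)

lemma batchTree_of_isPure (h : IsPure μ E) :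
    batchTree pick vote μ A E = .leaf (vote Finset.univ (classMass μ E)) := by
  rw [batchTree, if_pos h]

lemma batchTree_of_pick_eq_none
    (h : pick (Finset.insertNone A) (candidateGain (trueGain μ E)) = none) :
    batchTree pick vote μ A E = .leaf (vote Finset.univ (classMass μ E)) := by
  rw [batchTree]
  split_ifs
  · rfl
  · rw [h]

lemma batchTree_of_pick_eq_some {i : ι} (hE : ¬ IsPure μ E) (hi : i ∈ A)
    (h : pick (Finset.insertNone A) (candidateGain (trueGain μ E)) = some i) :
    batchTree pick vote μ A E
      = .node i fun a => batchTree pick vote μ (A.erase i) (branch E i a) := by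
  rw [batchTree, if_neg hE, h]
  simp only
  rw [dif_pos hi]

lemma NoTiesAlong.noTies : ∀ {T : DTree V C}, NoTiesAlong μ A E T → NoTies μ A E
  | .leaf _, h => h
  | .node _ _, h => h.1

/-- Along a typical stream, the history of a node eventually agrees with the asymptotic batch
tree below that node. -/
theorem eventually_agree [Nonempty C] (hpick : IsArgmaxRule pick) (hvote : IsArgmaxRule vote)
    (hS : Typical μ S) (A : Finset ι) (E : Set (Example V C)) (τ : ℕ)
    (hties : NoTiesAlong μ A E (batchTree pick vote μ A E)) :
    ∀ᶠ t in atTop, Agree μ E ((cellRun pick δ S A E τ t).toDTree vote)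
      (batchTree pick vote μ A E) := by
  induction A using Finset.strongInduction generalizing E τ with
  | H A ih =>
  have hleaf (hattempt : ∀ t, attemptToSplit pick δ A (cellRun pick δ S A E τ t).counts
        = .leaf (cellRun pick δ S A E τ t).counts)
      (hbatch : batchTree pick vote μ A E = .leaf (vote Finset.univ (classMass μ E))) :
      ∀ᶠ t in atTop, Agree μ E ((cellRun pick δ S A E τ t).toDTree vote)
        (batchTree pick vote μ A E) := by
    filter_upwards [eventually_vote (pick := pick) (δ := δ) (A := A) (E := E) hvote hS τ]
      with t ht
    rw [hbatch, cellRun_eq_leaf hattempt t, HTree.toDTree]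
    exact .leaf ht
  by_cases hE : IsPure μ E
  · exact hleaf (fun t => by rw [attemptToSplit, if_pos (sameClass_of_isPure hS hE τ t)])
      (batchTree_of_isPure hE)
  rcases A.eq_empty_or_nonempty with rfl | hA
  · have hnone (g : Option ι → ℝ) : pick (Finset.insertNone ∅) g = none := by
      cases h : pick (Finset.insertNone ∅) g with
      | none => rfl
      | some i => exact absurd (hpick.mem_of_eq_some h) (Finset.notMem_empty i)
    exact hleaf (fun t => by rw [attemptToSplit, hnone]; simp)
      (batchTree_of_pick_eq_none (hnone _))
  obtain ⟨i, hi, hp, hpos, hbest⟩ := hpick.exists_best hE hties.noTies hA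
  rw [batchTree_of_pick_eq_some hE hi hp] at hties ⊢
  obtain ⟨T, hT⟩ := eventually_atTop.1
    (eventually_dominates (pick := pick) (δ := δ) hS hE hi hpos hbest τ)
  -- Dominance alone does not change the tree: a visit is needed to install `i`. Its decision uses
  -- the counters after the increment, those of time `r + 1`.
  obtain ⟨r, hr, hvisit⟩ := hS.exists_visit (measure_ne_zero_of_not_isPure hE) (max T τ)
  have hd := hT (r + 1) (by omega)
  rw [cellRun_succ_of_mem (by omega) hvisit, counts_process] at hd
  obtain ⟨s, child, hrun⟩ := hd.exists_process_eq hpick hi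
    fun s j child h => (childrenAreRuns_cellRun hpick s j child h).1
  rw [← cellRun_succ_of_mem (by omega) hvisit] at hrun
  have hchild := fun a => exists_cellRun_le ((childrenAreRuns_cellRun hpick s i child hrun).2 a)
  -- The creation times of the branches depend on the stream, which is why the induction hypothesis
  -- allows every `τ`.
  choose σ hσ hchild using hchild
  have hlater := cellRun_eq_node_of_dominates hpick hi (T := r + 1)
    (fun t ht => hT t (by omega)) hσ ⟨s, child, hrun, hchild⟩
  filter_upwards [eventually_ge_atTop (r + 1), eventually_all.2 fun a =>
    ih (A.erase i) (Finset.erase_ssubset hi) (branch E i a) (σ a) (hties.2 a)] with t ht hagree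
  obtain ⟨s', child', hrun', hchild'⟩ := hlater t ht
  rw [hrun', HTree.toDTree]
  exact .node fun a => by rw [hchild' a]; exact hagree a

end Convergence

/-! ### Almost every stream is typical -/

section Probability

/-- Events that almost surely hold eventually have probability tending to `1`. -/
lemma tendsto_measure_of_ae_eventually {Ω : Type*} [MeasurableSpace Ω]
    {P : Measure Ω} [IsProbabilityMeasure P] {p : ℕ → Ω → Prop}
    (h : ∀ᵐ ω ∂P, ∀ᶠ t in atTop, p t ω) :
    Tendsto (fun t => P {ω | p t ω}) atTop (𝓝 1) := by
  -- The events "`p` holds from time `t` on" increase with `t`; continuity from below along them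
  -- requires no measurability.
  have hmono : Monotone fun t : ℕ => {ω | ∀ s, t ≤ s → p s ω} :=
    fun t t' htt' ω hω s hs => hω s (htt'.trans hs)
  have hlim := tendsto_measure_iUnion_atTop (μ := P) hmono
  have hunion : P (⋃ t : ℕ, {ω | ∀ s, t ≤ s → p s ω}) = 1 := by
    rw [← measure_univ (μ := P)]
    refine measure_congr (eventuallyEq_univ.2 ?_)
    filter_upwards [h] with ω hω
    exact Set.mem_iUnion.2 (eventually_atTop.1 hω)
  rw [hunion] at hlim
  exact tendsto_of_tendsto_of_tendsto_of_le_of_le hlim tendsto_const_nhds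
    (fun t => measure_mono fun ω hω => hω t le_rfl) fun t => prob_le_one

variable [Finite ι] [∀ i, Finite (V i)] [∀ i, MeasurableSpace (V i)]
  [∀ i, MeasurableSingletonClass (V i)] [Finite C] [MeasurableSpace C]
  [MeasurableSingletonClass C] {Ω : Type*} [MeasurableSpace Ω] {P : Measure Ω}
  [IsProbabilityMeasure P] {Z : ℕ → Ω → Example V C} {μ : Measure (Example V C)}

/-- The example space is finite: all its subsets are measurable and there are finitely many, so the
exceptional null sets can be combined. The frequencies come from the strong law for indicators. -/
theorem ae_typical (hZ : ∀ t, Measurable (Z t)) (hindep : iIndepFun Z P)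
    (hlaw : ∀ t, P.map (Z t) = μ) : ∀ᵐ ω ∂P, Typical μ fun n => Z n ω := by
  classical
  have hmeas (E : Set (Example V C)) : MeasurableSet E := E.toFinite.measurableSet
  have hfreq (E : Set (Example V C)) : ∀ᵐ ω ∂P,
      Tendsto (fun t : ℕ => (visits (fun n => Z n ω) E 0 t : ℝ) / t) atTop (𝓝 (μ.real E)) := by
    have hf : Measurable (E.indicator fun _ => (1 : ℝ)) :=
      measurable_const.indicator (hmeas E)
    have hslln := strong_law_ae_real (μ := P) (fun n => E.indicator (fun _ => (1 : ℝ)) ∘ Z n)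
      ((integrable_const (1 : ℝ)).indicator (hZ 0 (hmeas E)))
      (fun i j hij => (hindep.indepFun hij).comp hf hf)
      (fun n => IdentDistrib.comp
        ⟨(hZ n).aemeasurable, (hZ 0).aemeasurable, by rw [hlaw, hlaw]⟩ hf)
    have hint : ∫ ω, (E.indicator (fun _ => (1 : ℝ)) ∘ Z 0) ω ∂P = μ.real E := by
      rw [← hlaw 0, map_measureReal_apply (hZ 0) (hmeas E)]
      exact integral_indicator_one (hZ 0 (hmeas E))
    rw [hint] at hslln
    filter_upwards [hslln] with ω hω
    refine hω.congr fun t => ?_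
    congr 1
    simp [visits, Set.indicator_apply, Finset.sum_boole]
  have hnull (E : Set (Example V C)) : ∀ᵐ ω ∂P, μ E = 0 → ∀ t, Z t ω ∉ E := by
    by_cases hE : μ E = 0
    · have h : ∀ᵐ ω ∂P, ∀ t, Z t ω ∉ E := ae_all_iff.2 fun t => by
        rw [← hlaw t, Measure.map_apply (hZ t) (hmeas E)] at hE
        exact measure_eq_zero_iff_ae_notMem.1 hE
      filter_upwards [h] with ω hω _ using hω
    · exact Eventually.of_forall fun ω h => absurd h hE
  filter_upwards [ae_all_iff.2 hfreq, ae_all_iff.2 hnull] with ω h1 h2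
  exact ⟨h1, h2⟩

end Probability

end HATT

end

theorem lemma3 {ι : Type*} [Fintype ι] [DecidableEq ι]
    {V : ι → Type*} [∀ i, Fintype (V i)] [∀ i, DecidableEq (V i)]
    [∀ i, MeasurableSpace (V i)] [∀ i, MeasurableSingletonClass (V i)]
    {C : Type*} [Fintype C] [DecidableEq C] [MeasurableSpace C] [MeasurableSingletonClass C]
    {Ω : Type*} [MeasurableSpace Ω] (P : Measure Ω) [IsProbabilityMeasure P]
    -- the stream of examples, i.i.d. with law `μ`
    (Z : ℕ → Ω → HATT.Example V C) (μ : Measure (HATT.Example V C))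
    (hZ : ∀ t, Measurable (Z t)) (hindep : iIndepFun Z P) (hlaw : ∀ t, P.map (Z t) = μ)
    -- the tolerance and the (arbitrary) tie-breaking rules
    (δ : ℝ) (hδ0 : 0 < δ) (hδ1 : δ < 1)
    (pick : Finset (Option ι) → (Option ι → ℝ) → Option ι) (hpick : HATT.IsArgmaxRule pick)
    (vote : Finset C → (C → ℝ) → C) (hvote : HATT.IsArgmaxRule vote)
    -- no two attributes have equal information gain at a node of the asymptotic batch tree
    (hties : HATT.NoTiesAlong μ Finset.univ Set.univ
      (HATT.batchTree pick vote μ Finset.univ Set.univ)) :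
    Tendsto
      (fun t : ℕ => P {ω | HATT.Agree μ Set.univ
        (HATT.hatt pick vote δ (fun n => Z n ω) t)
        (HATT.batchTree pick vote μ Finset.univ Set.univ)})
      atTop (𝓝 1) := by
  have : Nonempty Ω := nonempty_of_isProbabilityMeasure P
  have : Nonempty C := ⟨(Z 0 (Classical.arbitrary Ω)).2⟩
  have : IsProbabilityMeasure μ := by
    rw [← hlaw 0]; exact Measure.isProbabilityMeasure_map (hZ 0).aemeasurable
  refine HATT.tendsto_measure_of_ae_eventually ?_
  filter_upwards [HATT.ae_typical hZ hindep hlaw] with ω hω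
  filter_upwards [HATT.eventually_agree (δ := δ) hpick hvote hω Finset.univ Set.univ 0 hties]
    with t ht
  rw [HATT.hatt, HATT.state_eq_cellRun]
  exact ht
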